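/- Consider an AC power network with a slack bus $0$, whose voltage is $V_0=1$, and $n$ PQ-buses $1,\dots,n$ with complex voltages $V_1,\dots,V_n$. Write $i\sim k$ if the buses $i$ and $k$ are joined by a line, and let $y_{ik}=y_{ki}\in\mathbb C$, $y_{ik}\neq 0$, be the admittance of that line. The power flow equations are $$P_i+jQ_i=V_i\sum_{k\sim i}y_{ik}^*(V_i-V_k)^*,\qquad i=1,\dots,n,$$ where $j$ is the imaginary unit and ${}^*$ denotes complex conjugation. The real solvability set is the set of all $(P_1,\dots,P_n)\in\mathbb R^n$ for which there are reactive powers $(Q_1,\dots,Q_n)\in\mathbb R^n$ such that the power flow equations have a solution $(V_1,\dots,V_n)\in\mathbb C^n$. Theorem. Suppose that the network graph on the buses $0,1,\dots,n$ is a tree (connected and acyclic), and that $\Re(y_{ik})\ge 0$ for every line $i\sim k$ (that is, all line resistances are non-negative; purely reactive lines, with $\Re(y_{ik})=0$, are allowed). Then the real solvability set is a convex subset of $\mathbb R^n$. -/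

import Mathlib

/-- An AC power network with the slack bus `0` and the PQ-buses `1, …, n`: the graph of lines
`i ∼ k`, and the line admittances `y i k`, which are symmetric and nonzero on every line
(only their values on lines matter). -/
structure PowerNetwork (n : ℕ) where
  graph : SimpleGraph (Fin (n + 1))
  y : Fin (n + 1) → Fin (n + 1) → ℂ
  y_symm : ∀ i k, y i k = y k i
  y_ne_zero : ∀ i k, graph.Adj i k → y i k ≠ 0

namespace PowerNetwork

/-- The voltages at all buses: the slack voltage is `1`, the other ones are given by `V`. -/
noncomputable def busVoltage {n : ℕ} (V : Fin n → ℂ) : Fin (n + 1) → ℂ :=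
  Fin.cons 1 V

open Classical in
/-- The complex power `S_i = V_i ∑_{k ∼ i} y_{ik}^* (V_i - V_k)^*` injected at the bus `i`, when
the voltages at all buses are `U`. -/
noncomputable def powerInjection {n : ℕ} (N : PowerNetwork n) (U : Fin (n + 1) → ℂ)
    (i : Fin (n + 1)) : ℂ :=
  U i * ∑ k with N.graph.Adj i k,
    (starRingEnd ℂ) (N.y i k) * (starRingEnd ℂ) (U i - U k)

/-- `V` solves the power flow equations `P_i + j Q_i = S_i`, `i = 1, …, n`. -/
def IsPowerFlowSolution {n : ℕ} (N : PowerNetwork n) (P Q : Fin n → ℝ) (V : Fin n → ℂ) : Prop :=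
  ∀ i : Fin n, (P i : ℂ) + Complex.I * (Q i : ℂ) = N.powerInjection (busVoltage V) i.succ

/-- The real solvability set: all `(P_1, …, P_n)` such that, for at least some `(Q_1, …, Q_n)`,
the power flow equations have a solution. -/
def realSolvabilitySet {n : ℕ} (N : PowerNetwork n) : Set (Fin n → ℝ) :=
  {P | ∃ Q : Fin n → ℝ, ∃ V : Fin n → ℂ, N.IsPowerFlowSolution P Q V}

end PowerNetwork

open ComplexConjugate

/-! Active powers are linear in the squared voltages `u i` and the products `w i k = V_i V_k^*`. A
convex combination of two solutions thus has the desired powers, but satisfies only the relaxation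
`|w i k|² ≤ u i * u k` (`normSq_mix_le`). On a tree it is made exact line by line, outward from the
slack bus, keeping the active flow at both ends of each line (`exists_voltage_of_relaxed_line`).
Squared voltages never drop below `u`, so the next line can be treated in the same way. -/

/-- A quadratic with positive leading and nonpositive constant coefficient has a root `r ≥ 0`. -/
theorem exists_nonneg_root_of_const_nonpos {D L c : ℝ} (hD : 0 < D) (hc : c ≤ 0) :
    ∃ r, 0 ≤ r ∧ D * r ^ 2 + L * r + c = 0 := by
  have hdisc : 0 ≤ L ^ 2 - 4 * D * c := by nlinarith [sq_nonneg L, mul_nonneg hD.le (neg_nonneg.2 hc)]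
  have hle : L ≤ √(L ^ 2 - 4 * D * c) :=
    Real.le_sqrt_of_sq_le (by nlinarith [mul_nonneg hD.le (neg_nonneg.2 hc)])
  refine ⟨(√(L ^ 2 - 4 * D * c) - L) / (2 * D), div_nonneg (sub_nonneg.2 hle) (by positivity), ?_⟩
  have hsq := Real.sq_sqrt hdisc
  generalize √(L ^ 2 - 4 * D * c) = q at hsq
  field_simp
  linear_combination hsq

/-- With the active power flows at both ends of a line of admittance `g + jb` fixed, and the squared
voltage `u` at one end raised to `a`, a relaxed state `(u, v, c + js)` of the line, that is
`c² + s² ≤ u v`, can be replaced by an exact one, without lowering `v`. -/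
theorem exists_exact_line_state {g b u v c s a : ℝ} (hy : 0 < b ^ 2 + g ^ 2) (hu : 0 ≤ u)
    (hv : 0 ≤ v) (hw : c ^ 2 + s ^ 2 ≤ u * v) (ha : u ≤ a) :
    ∃ v' c' s', v ≤ v' ∧ c' ^ 2 + s' ^ 2 = a * v' ∧
      g * a - g * c' - b * s' = g * u - g * c - b * s ∧
      g * v' - g * c' + b * s' = g * v - g * c + b * s := by
  have hc : 2 * c ≤ u + v :=
    le_of_sq_le_sq (by nlinarith [sq_nonneg (u - v), sq_nonneg s]) (by positivity)
  -- Adding `a - u` to `u`, `v` and `c` preserves both flows, and keeps the relaxation because `2 *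
  -- c ≤ u + v`.
  have hshift : (c + (a - u)) ^ 2 + s ^ 2 - a * (v + (a - u)) ≤ 0 := by
    nlinarith [mul_nonneg (sub_nonneg.2 ha) (sub_nonneg.2 hc)]
  obtain ⟨ε, hε, hεb⟩ : ∃ ε : ℝ, ε ^ 2 = 1 ∧ 0 ≤ b * ε := by
    rcases le_total 0 b with h | h
    · exact ⟨1, by norm_num, by simpa using h⟩
    · exact ⟨-1, by norm_num, by simpa using h⟩
  obtain ⟨r, hr, hroot⟩ := exists_nonneg_root_of_const_nonpos
    (L := 2 * (c + (a - u)) * b * ε - 2 * s * g * ε - 2 * a * b * ε) hy hshift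
  -- With the first squared voltage fixed, `(v, c, s)` can move along `(2b, b, -g)` without changing
  -- either flow; the sign `ε` makes `v` grow, and the root `r` gives equality.
  refine ⟨v + (a - u) + 2 * (b * ε) * r, c + (a - u) + b * ε * r, s - g * ε * r, ?_, ?_, ?_, ?_⟩
  · nlinarith [mul_nonneg hεb hr]
  · linear_combination hroot + r ^ 2 * (b ^ 2 + g ^ 2) * hε
  · ring
  · ring

/-- Two nonnegative squared moduli and a complex number whose squared modulus is their product are
realised by two complex numbers, the first of which may be prescribed. -/
theorem exists_mul_conj_eq {x w : ℂ} {v : ℝ} (hv : 0 ≤ v)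
    (hw : Complex.normSq w = Complex.normSq x * v) :
    ∃ z : ℂ, Complex.normSq z = v ∧ x * conj z = w := by
  by_cases hx : x = 0
  · subst hx
    refine ⟨(√v : ℝ), ?_, ?_⟩
    · rw [Complex.normSq_ofReal, Real.mul_self_sqrt hv]
    · rw [zero_mul, Complex.normSq_eq_zero.1 (hw.trans (by simp))]
  · have hx' : Complex.normSq x ≠ 0 := by simpa using hx
    refine ⟨conj (w / x), ?_, ?_⟩
    · rw [Complex.normSq_conj, Complex.normSq_div, hw]
      field_simp
    · rw [Complex.conj_conj, mul_div_cancel₀ _ hx]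

/-- The voltage form of `exists_exact_line_state`. -/
theorem exists_voltage_of_relaxed_line {y w x : ℂ} {u v : ℝ} (hy : y ≠ 0) (hu : 0 ≤ u)
    (hv : 0 ≤ v) (hw : Complex.normSq w ≤ u * v) (hx : u ≤ Complex.normSq x) :
    ∃ z : ℂ, v ≤ Complex.normSq z ∧
      (conj y * (x * conj (x - z))).re = (conj y * (u - w)).re ∧
      (conj y * (z * conj (z - x))).re = (conj y * (v - conj w)).re := by
  have hy' : 0 < y.im ^ 2 + y.re ^ 2 := by
    have := Complex.normSq_pos.2 hy
    rw [Complex.normSq_apply] at this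
    linarith
  rw [Complex.normSq_apply] at hw
  obtain ⟨v', c, s, hvv, hcs, h1, h2⟩ := exists_exact_line_state (g := y.re) (b := y.im)
    (c := w.re) (s := w.im) hy' hu hv (by linarith) hx
  obtain ⟨z, hz, hxz⟩ := exists_mul_conj_eq (x := x) (w := ⟨c, s⟩) (hv.trans hvv)
    (by rw [← hcs, Complex.normSq_apply]; ring)
  have hre := congrArg Complex.re hxz
  have him := congrArg Complex.im hxz
  simp only [Complex.mul_re, Complex.mul_im, Complex.conj_re, Complex.conj_im] at hre him
  rw [Complex.normSq_apply] at hz h1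
  refine ⟨z, by rw [Complex.normSq_apply, hz]; exact hvv, ?_, ?_⟩
  · simp only [Complex.mul_re, Complex.mul_im, Complex.conj_re, Complex.conj_im, Complex.sub_re,
      Complex.sub_im, Complex.ofReal_re, Complex.ofReal_im]
    linear_combination h1 - y.re * hre - y.im * him
  · simp only [Complex.mul_re, Complex.mul_im, Complex.conj_re, Complex.conj_im, Complex.sub_re,
      Complex.sub_im, Complex.ofReal_re, Complex.ofReal_im]
    linear_combination h2 + y.re * hz - y.re * hre + y.im * him

/-- The value at the start of a walk obtained by propagating `x₀` backwards from its end. -/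
def SimpleGraph.Walk.propagate {V α : Type*} {G : SimpleGraph V} (F : V → V → α → α) (x₀ : α) :
    {u v : V} → G.Walk u v → α
  | _, _, .nil => x₀
  | u, _, .cons (v := v) _ p => F v u (p.propagate F x₀)

/-- Values on a tree can be chosen edge by edge, starting at a root. -/
theorem SimpleGraph.IsTree.exists_forall_adj {V α : Type*} {G : SimpleGraph V} (hG : G.IsTree)
    (r : V) (x₀ : α) (Q : V → α → Prop) (R : V → V → α → α → Prop)
    (hR : ∀ a b x z, G.Adj a b → R a b x z → R b a z x) (h₀ : Q r x₀)
    (hstep : ∀ a b x, G.Adj a b → Q a x → ∃ z, Q b z ∧ R a b x z) :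
    ∃ f : V → α, f r = x₀ ∧ ∀ a b, G.Adj a b → R a b (f a) (f b) := by
  have hF : ∀ a b x, ∃ z, G.Adj a b → Q a x → Q b z ∧ R a b x z := fun a b x => by
    by_cases h : G.Adj a b ∧ Q a x
    · obtain ⟨z, hz⟩ := hstep a b x h.1 h.2
      exact ⟨z, fun _ _ => hz⟩
    · exact ⟨x, fun h1 h2 => absurd ⟨h1, h2⟩ h⟩
  choose F hF using hF
  have hQ : ∀ {u v : V} (p : G.Walk u v), v = r → Q u (p.propagate F x₀) := by
    intro u v p hv
    induction p with
    | nil => subst hv; exact h₀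
    | cons h p ih => exact (hF _ _ _ h.symm (ih hv)).1
  choose p hp hpu using fun v => hG.existsUnique_path v r
  have hcons : ∀ a b (h : G.Adj b a), b ∉ (p a).support →
      R a b ((p a).propagate F x₀) ((p b).propagate F x₀) := by
    intro a b h hb
    rw [← hpu b (.cons h (p a)) ((hp a).cons hb)]
    exact (hF _ _ _ h.symm (hQ (p a) rfl)).2
  refine ⟨fun v => (p v).propagate F x₀, ?_, fun a b h => ?_⟩
  · show (p r).propagate F x₀ = x₀
    rw [← hpu r .nil .nil]
    rfl
  -- Of two adjacent vertices, one lies off the other's path to the root and is its child; the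
  -- symmetry `hR` covers both orders.
  · by_cases hb : b ∈ (p a).support
    · refine hR _ _ _ _ h.symm (hcons b a h fun ha => ?_)
      exact hG.isAcyclic.ne_mem_support_of_support_of_adj_of_isPath (hp a).reverse (hp b).reverse h
        (by simpa using hb) (by simpa using ha)
    · exact hcons a b h.symm hb

namespace PowerNetwork

variable {n : ℕ}

open Classical in
theorem re_powerInjection (N : PowerNetwork n) (U : Fin (n + 1) → ℂ) (i : Fin (n + 1)) :
    (N.powerInjection U i).re =
      ∑ k with N.graph.Adj i k, (conj (N.y i k) * (U i * conj (U i - U k))).re := by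
  rw [powerInjection, Finset.mul_sum, Complex.re_sum]
  exact Finset.sum_congr rfl fun k _ => by rw [mul_left_comm]

theorem mem_realSolvabilitySet_iff (N : PowerNetwork n) (P : Fin n → ℝ) :
    P ∈ N.realSolvabilitySet ↔
      ∃ U : Fin (n + 1) → ℂ, U 0 = 1 ∧ ∀ i, P i = (N.powerInjection U i.succ).re := by
  constructor
  · rintro ⟨Q, V, h⟩
    exact ⟨busVoltage V, rfl, fun i => by simp [← h i]⟩
  · rintro ⟨U, hU, h⟩
    have hUV : busVoltage (fun i => U i.succ) = U := by
      rw [busVoltage, ← hU]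
      exact Fin.cons_self_tail U
    refine ⟨fun i => (N.powerInjection U i.succ).im, fun i => U i.succ, fun i => ?_⟩
    rw [hUV, h, mul_comm Complex.I]
    exact Complex.re_add_im _

end PowerNetwork

/-- Cauchy–Schwarz, with the defect given by Lagrange's identity. -/
theorem normSq_mix_le {s t : ℝ} (hs : 0 ≤ s) (ht : 0 ≤ t) (a b a' b' : ℂ) :
    Complex.normSq (s * (a * conj b) + t * (a' * conj b')) ≤
      (s * Complex.normSq a + t * Complex.normSq a') *
        (s * Complex.normSq b + t * Complex.normSq b') := by
  have h : (s * Complex.normSq a + t * Complex.normSq a') *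
        (s * Complex.normSq b + t * Complex.normSq b') -
      Complex.normSq (s * (a * conj b) + t * (a' * conj b')) =
      s * t * Complex.normSq (a * b' - a' * b) := by
    simp only [Complex.normSq_apply, Complex.mul_re, Complex.mul_im, Complex.conj_re,
      Complex.conj_im, Complex.sub_re, Complex.sub_im, Complex.add_re, Complex.add_im,
      Complex.ofReal_re, Complex.ofReal_im]
    ring
  have := mul_nonneg (mul_nonneg hs ht) (Complex.normSq_nonneg (a * b' - a' * b))
  linarith

theorem theorem2 {n : ℕ} (N : PowerNetwork n) (hTree : N.graph.IsTree)
    (hRes : ∀ i k, N.graph.Adj i k → 0 ≤ (N.y i k).re) :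
    Convex ℝ N.realSolvabilitySet := by
  classical
  intro P hP P' hP' s t hs ht hst
  rw [PowerNetwork.mem_realSolvabilitySet_iff] at hP hP' ⊢
  obtain ⟨U, hU, hP⟩ := hP
  obtain ⟨U', hU', hP'⟩ := hP'
  set u : Fin (n + 1) → ℝ := fun i => s * Complex.normSq (U i) + t * Complex.normSq (U' i) with hu
  set w : Fin (n + 1) → Fin (n + 1) → ℂ :=
    fun i k => s * (U i * conj (U k)) + t * (U' i * conj (U' k)) with hw
  have hu0 : ∀ i, 0 ≤ u i := fun i =>
    add_nonneg (mul_nonneg hs (Complex.normSq_nonneg _)) (mul_nonneg ht (Complex.normSq_nonneg _))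
  have hwc : ∀ i k, conj (w i k) = w k i := fun i k => by
    simp only [hw, map_add, map_mul, Complex.conj_ofReal, Complex.conj_conj]
    ring
  -- The invariant holds at the root since `u 0 = s + t = 1`.
  obtain ⟨X, hX0, hX⟩ := hTree.exists_forall_adj 0 (1 : ℂ) (fun i x => u i ≤ Complex.normSq x)
    (fun i k x z =>
      (conj (N.y i k) * (x * conj (x - z))).re = (conj (N.y i k) * (u i - w i k)).re ∧
      (conj (N.y i k) * (z * conj (z - x))).re = (conj (N.y i k) * (u k - w k i)).re)
    (fun i k x z _ h => by rw [N.y_symm k i]; exact h.symm)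
    (by simp [hu, hU, hU', hst])
    (fun i k x hik hx => by
      rw [← hwc i k]
      exact exists_voltage_of_relaxed_line (N.y_ne_zero i k hik) (hu0 i) (hu0 k)
        (normSq_mix_le hs ht _ _ _ _) hx)
  refine ⟨X, hX0, fun i => ?_⟩
  rw [Pi.add_apply, Pi.smul_apply, Pi.smul_apply, smul_eq_mul, smul_eq_mul, hP, hP',
    N.re_powerInjection, N.re_powerInjection, N.re_powerInjection, Finset.mul_sum, Finset.mul_sum,
    ← Finset.sum_add_distrib]
  refine Finset.sum_congr rfl fun k hk => ?_
  rw [(hX _ _ (Finset.mem_filter.1 hk).2).1]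
  simp only [hu, hw, Complex.normSq_apply, Complex.mul_re, Complex.mul_im, Complex.conj_re,
    Complex.conj_im, Complex.sub_re, Complex.sub_im, Complex.add_re, Complex.add_im,
    Complex.ofReal_re, Complex.ofReal_im]
  ring
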